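/- Let $K$ be a field that is complete with respect to an absolute value. A variety over $K$ is a separated, geometrically reduced scheme of finite type over $K$, not necessarily irreducible. For a $K$-scheme $X$ let $X(K)$ be the set of its $K$-rational points, i.e. of $K$-morphisms $\operatorname{Spec} K \to X$. The strong topology on $X(K)$ is the coarsest topology for which, for every Zariski open $U \subseteq X$, the subset $U(K) \subseteq X(K)$ is open and every regular function $f \in \mathcal{O}_X(U)$ is continuous as a map $U(K) \to K$; on $\mathbb{A}^r_K(K) = K^r$ it is the product topology. Theorem (Implicit function theorem). Let $X$ be an $r$-dimensional variety over $K$, let $\varphi : X \to \mathbb{A}^r_K$ be a $K$-morphism, and let $p \in X(K)$ be a $K$-rational point such that $\varphi$ is étale at $p$ (i.e. étale on some Zariski open neighbourhood of $p$); its image $\varphi(p)$ is then a $K$-rational point of $\mathbb{A}^r_K$. Then the induced map $\varphi_K : X(K) \to \mathbb{A}^r_K(K) = K^r$ is a homeomorphism near $p$ in the strong topology: there are a strongly open neighbourhood $V$ of $p$ in $X(K)$ and a strongly open neighbourhood $W$ of $\varphi_K(p)$ in $\mathbb{A}^r_K(K)$ such that $\varphi_K$ restricts to a homeomorphism $V \to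 W$. -/

import Mathlib

open CategoryTheory AlgebraicGeometry

universe u

/-- A variety over a field `K`: a scheme over `Spec K` that is separated, of finite type and
geometrically reduced over `K`. It need not be irreducible. -/
class IsVariety (K : Type u) [Field K] (X : Scheme.{u}) [X.Over (Spec (.of K))] : Prop where
  isSeparated : IsSeparated (X ↘ Spec (.of K))
  locallyOfFiniteType : LocallyOfFiniteType (X ↘ Spec (.of K))
  quasiCompact : QuasiCompact (X ↘ Spec (.of K))
  geometricallyReduced : GeometricallyReduced (X ↘ Spec (.of K))

/-- The set `X(K)` of `K`-rational points of a `K`-scheme `X`: the `K`-morphisms `Spec K ⟶ X`. -/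
@[ext]
structure RationalPoints (K : Type u) [Field K] (X : Scheme.{u}) [X.Over (Spec (.of K))] where
  hom : Spec (.of K) ⟶ X
  hom_over : hom ≫ (X ↘ Spec (.of K)) = 𝟙 (Spec (.of K))

namespace RationalPoints

variable {K : Type u} [Field K] {X Y : Scheme.{u}} [X.Over (Spec (.of K))] [Y.Over (Spec (.of K))]

/-- The point of the topological space of `X` that underlies a `K`-rational point. -/
noncomputable def pt (x : RationalPoints K X) : X :=
  x.hom (IsLocalRing.closedPoint K)

theorem top_le_preimage (x : RationalPoints K X) {U : X.Opens} (hx : x.pt ∈ U) :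
    ⊤ ≤ x.hom ⁻¹ᵁ U := by
  intro s _
  obtain rfl : s = IsLocalRing.closedPoint K := Subsingleton.elim (α := PrimeSpectrum K) _ _
  exact hx

/-- The value `f(x) ∈ K` of a regular function `f ∈ Γ(X, U)` at a `K`-rational point `x` lying
in the Zariski open set `U`. -/
noncomputable def eval (x : RationalPoints K X) {U : X.Opens} (hx : x.pt ∈ U) : Γ(X, U) →+* K :=
  (x.hom.appLE U ⊤ (x.top_le_preimage hx) ≫ (Scheme.ΓSpecIso (.of K)).hom).hom

/-- The map `φ_K : X(K) → Y(K)` induced by a `K`-morphism `φ : X ⟶ Y`. -/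
noncomputable def map (φ : X ⟶ Y) [φ.IsOver (Spec (.of K))] (x : RationalPoints K X) : RationalPoints K Y :=
  ⟨x.hom ≫ φ, by rw [Category.assoc, comp_over, x.hom_over]⟩

/-- The strong topology on `X(K)`: the coarsest topology in which, for every Zariski open `U ⊆ X`,
the set `U(K)` is open in `X(K)` and every regular function `f ∈ Γ(X, U)` is continuous as a
function `U(K) → K`. -/
instance strongTopology [TopologicalSpace K] : TopologicalSpace (RationalPoints K X) :=
  TopologicalSpace.generateFrom
    {s | ∃ (U : X.Opens) (f : Γ(X, U)) (W : Set K), IsOpen W ∧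
      s = {x | ∃ hx : x.pt ∈ U, x.eval hx f ∈ W}}

/- The rest of this namespace proves the properties that characterize the strong topology:
`𝔸ⁿ(K) = Kⁿ`, compatibility with products, and the subspace topology for immersions. -/

section StrongTopology

open TopologicalSpace Topology Filter

theorem pt_map (φ : X ⟶ Y) [φ.IsOver (Spec (.of K))] (x : RationalPoints K X) :
    (x.map φ).pt = φ x.pt :=
  Scheme.Hom.comp_apply _ _ _

theorem eval_res (x : RationalPoints K X) {U V : X.Opens} (i : V ≤ U) (hx : x.pt ∈ V)
    (f : Γ(X, U)) : x.eval hx (X.presheaf.map (homOfLE i).op f) = x.eval (i hx) f := by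
  simp only [eval]
  rw [← CommRingCat.comp_apply, ← Category.assoc, Scheme.Hom.map_appLE]

theorem eval_map (φ : X ⟶ Y) [φ.IsOver (Spec (.of K))] (x : RationalPoints K X) {U : Y.Opens}
    (hx : (x.map φ).pt ∈ U) (f : Γ(Y, U)) :
    (x.map φ).eval hx f = x.eval (U := φ ⁻¹ᵁ U) (by rwa [pt_map] at hx) (φ.app U f) := by
  simp only [eval, map]
  rw [← CommRingCat.comp_apply, ← Category.assoc, Scheme.Hom.comp_appLE]

theorem eval_top (x : RationalPoints K X) (f : Γ(X, ⊤)) :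
    x.eval (U := ⊤) (Opens.mem_top _) f = (Scheme.ΓSpecIso (.of K)).hom (x.1.appTop f) := by
  simp only [eval]
  rw [CommRingCat.comp_apply]
  congr 2

theorem eval_over (x : RationalPoints K X) (c : K) :
    x.eval (U := ⊤) (Opens.mem_top _) ((X ↘ Spec (.of K)).appTop ((Scheme.ΓSpecIso (.of K)).inv c)) = c := by
  rw [eval_top, ← CommRingCat.comp_apply (X ↘ Spec (.of K)).appTop, ← Scheme.Hom.comp_appTop, x.2]
  simp

theorem pt_mem_basicOpen (x : RationalPoints K X) {U : X.Opens} (hx : x.pt ∈ U) (f : Γ(X, U)) :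
    x.pt ∈ X.basicOpen f ↔ x.eval hx f ≠ 0 := by
  have h1 : x.pt ∈ X.basicOpen f ↔ IsLocalRing.closedPoint K ∈
      (Spec (.of K)).basicOpen (x.1.appLE U ⊤ (x.top_le_preimage hx) f) := by
    rw [Scheme.basicOpen_appLE]
    exact ⟨fun h ↦ ⟨trivial, h⟩, fun h ↦ h.2⟩
  rw [h1, basicOpen_eq_of_affine']
  change (_ ∉ IsLocalRing.maximalIdeal K) ↔ _
  simp [eval]

open Classical in
/-- The value of `f ∈ Γ(X, U)` at `x`, extended by zero to the points outside `U`; auxiliary. -/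
noncomputable def evalD (x : RationalPoints K X) {U : X.Opens} (f : Γ(X, U)) : K :=
  if hx : x.pt ∈ U then x.eval hx f else 0

theorem evalD_eq (x : RationalPoints K X) {U : X.Opens} (hx : x.pt ∈ U) (f : Γ(X, U)) :
    x.evalD f = x.eval hx f := dif_pos hx

theorem evalD_map_appLE (φ : X ⟶ Y) [φ.IsOver (Spec (.of K))] (x : RationalPoints K X)
    {U : Y.Opens} {V : X.Opens} (h : V ≤ φ ⁻¹ᵁ U) (hx : x.pt ∈ V) (f : Γ(Y, U)) :
    x.evalD (φ.appLE U V h f) = (x.map φ).evalD f := by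
  have hx' : (x.map φ).pt ∈ U := by rw [pt_map]; exact h hx
  rw [evalD_eq _ hx, evalD_eq _ hx', eval_map, ← eval_res x h hx]
  rfl

variable {n : Type u}

theorem closure_coord_union_const :
    Subring.closure (Set.range (AffineSpace.coord (n := n) (Spec (.of K))) ∪ Set.range fun c : K ↦
      ((𝔸(n; Spec (.of K)) ↘ Spec (.of K)).appTop ((Scheme.ΓSpecIso (.of K)).inv c))) = ⊤ := by
  have h : Function.Surjective (AffineSpace.SpecIso n (.of K)).hom.appTop :=
    (ConcreteCategory.bijective_of_isIso ((AffineSpace.SpecIso n (.of K)).hom.app ⊤)).2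
  rw [AffineSpace.SpecIso_hom_appTop] at h
  rw [eq_top_iff]
  rintro f -
  obtain ⟨P, rfl⟩ := h f
  rw [CommRingCat.comp_apply]
  generalize (Scheme.ΓSpecIso _).hom P = Q
  induction Q using MvPolynomial.induction_on with
  | C a => 
    refine Subring.subset_closure (Or.inr ⟨a, ?_⟩)
    simp
  | add p q hp hq => rw [map_add]; exact add_mem hp hq
  | mul_X p i hp => 
    rw [map_mul]
    refine mul_mem hp (Subring.subset_closure (Or.inl ⟨i, ?_⟩))
    simp

variable {Z : Scheme.{u}} {fst : Z ⟶ X} {snd : Z ⟶ Y}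

theorem closure_appLE (H : IsPullback fst snd (X ↘ Spec (.of K)) (Y ↘ Spec (.of K)))
    {U : X.Opens} {V : Y.Opens} (hU : IsAffineOpen U) (hV : IsAffineOpen V) :
    IsAffineOpen (fst ⁻¹ᵁ U ⊓ snd ⁻¹ᵁ V) ∧
    Subring.closure (Set.range (fst.appLE U (fst ⁻¹ᵁ U ⊓ snd ⁻¹ᵁ V) inf_le_left) ∪
      Set.range (snd.appLE V (fst ⁻¹ᵁ U ⊓ snd ⁻¹ᵁ V) inf_le_right)) = ⊤ := by
  have h := Scheme.Hom.isPullback_resLE H (US := ⊤) (UX := U) (UT := V) le_top le_top rfl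
  have h1 : IsAffine U := hU
  have h2 : IsAffine V := hV
  have h3 : IsAffine (⊤ : (Spec (.of K)).Opens) := isAffineOpen_top _
  refine ⟨.of_isPullback h, ?_⟩
  have h4 := CommRingCat.closure_range_union_range_eq_top_of_isPushout
    (isPushout_appTop_of_isPullback h)
  have e1 : U.topIso.hom ≫ fst.appLE U (fst ⁻¹ᵁ U ⊓ snd ⁻¹ᵁ V) inf_le_left = _ :=
    (arrowResLEAppIso fst U (fst ⁻¹ᵁ U ⊓ snd ⁻¹ᵁ V) inf_le_left).hom.w
  have e2 : V.topIso.hom ≫ snd.appLE V (fst ⁻¹ᵁ U ⊓ snd ⁻¹ᵁ V) inf_le_right = _ :=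
    (arrowResLEAppIso snd V (fst ⁻¹ᵁ U ⊓ snd ⁻¹ᵁ V) inf_le_right).hom.w
  rw [eq_top_iff]
  rintro f -
  obtain ⟨g, rfl⟩ := (ConcreteCategory.bijective_of_isIso
    (fst ⁻¹ᵁ U ⊓ snd ⁻¹ᵁ V).topIso.hom).2 f
  have hg : (fst ⁻¹ᵁ U ⊓ snd ⁻¹ᵁ V).topIso.hom.hom g ∈
      Subring.map (fst ⁻¹ᵁ U ⊓ snd ⁻¹ᵁ V).topIso.hom.hom (Subring.closure _) :=
    Subring.mem_map.2 ⟨g, h4.ge (Subring.mem_top g), rfl⟩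
  rw [RingHom.map_closure] at hg
  refine Subring.closure_mono ?_ hg
  rintro _ ⟨_, ⟨a, rfl⟩ | ⟨a, rfl⟩, rfl⟩
  · exact Or.inl ⟨U.topIso.hom a, congr($e1 a)⟩
  · exact Or.inr ⟨V.topIso.hom a, congr($e2 a)⟩

variable [TopologicalSpace K]

theorem isOpen_eval {U : X.Opens} (f : Γ(X, U)) {W : Set K} (hW : IsOpen W) :
    IsOpen {x : RationalPoints K X | ∃ hx : x.pt ∈ U, x.eval hx f ∈ W} :=
  isOpen_generateFrom_of_mem ⟨U, f, W, hW, rfl⟩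

theorem isOpen_pt_mem (U : X.Opens) : IsOpen {x : RationalPoints K X | x.pt ∈ U} := by
  convert! isOpen_eval (0 : Γ(X, U)) (isOpen_univ (X := K)) using 2 with x
  simp

/-- A morphism induces a continuous map on rational points. -/
theorem continuous_map (φ : X ⟶ Y) [φ.IsOver (Spec (.of K))] :
    Continuous (map φ : RationalPoints K X → RationalPoints K Y) := by
  refine continuous_generateFrom_iff.2 ?_
  rintro _ ⟨U, f, W, hW, rfl⟩
  refine isOpen_generateFrom_of_mem ⟨φ ⁻¹ᵁ U, φ.app U f, W, hW, ?_⟩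
  ext x
  simp only [Set.mem_preimage, Set.mem_ofPred_eq, eval_map]
  simp only [pt_map]
  rfl

theorem isInducing_map (φ : X ⟶ Y) [φ.IsOver (Spec (.of K))] [IsPreimmersion φ] :
    IsInducing (map φ : RationalPoints K X → RationalPoints K Y) := by
  refine ⟨le_antisymm (continuous_map φ).le_induced ?_⟩
  refine le_generateFrom ?_
  rintro _ ⟨V, f, W, hW, rfl⟩
  let _ : TopologicalSpace (RationalPoints K X) := induced (map φ) strongTopology
  rw [isOpen_iff_mem_nhds]
  rintro x ⟨hx, hfx⟩
  obtain ⟨s, hs⟩ := Scheme.Hom.stalkMap_surjective φ x.pt (X.presheaf.germ V x.pt hx f)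
  obtain ⟨U, hU, g, rfl⟩ := Y.presheaf.exists_germ_eq s
  rw [Scheme.Hom.germ_stalkMap_apply] at hs
  obtain ⟨V', hV', i₁, i₂, h⟩ := X.presheaf.germ_eq _ _ _ _ _ hs
  obtain ⟨U', hU', hUV⟩ := φ.isEmbedding.isInducing.isOpen_iff.1 V'.2
  refine mem_nhds_induced .. |>.2 ⟨{y | ∃ hy : y.pt ∈ U ⊓ ⟨U', hU'⟩,
    y.eval hy (Y.presheaf.map (homOfLE inf_le_left).op g) ∈ W}, IsOpen.mem_nhds
      (isOpen_eval _ hW) ?_, ?_⟩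
  all_goals
    have key : ∀ z : RationalPoints K X, ∀ hz : (z.map φ).pt ∈ U ⊓ ⟨U', hU'⟩,
        ∃ hz' : z.pt ∈ V, (z.map φ).eval hz (Y.presheaf.map (homOfLE inf_le_left).op g) =
          z.eval hz' f := by
      intro z hz
      have hzV : z.pt ∈ V' := by
        rw [pt_map] at hz
        change z.pt ∈ V'.carrier
        rw [← hUV]
        exact hz.2
      refine ⟨i₂.le hzV, ?_⟩
      rw [eval_res, eval_map, ← eval_res z i₁.le hzV, ← eval_res z i₂.le hzV]
      exact congrArg _ h
  · have hm : (x.map φ).pt ∈ U ⊓ ⟨U', hU'⟩ := by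
      rw [pt_map]
      refine ⟨hU, ?_⟩
      change x.pt ∈ φ ⁻¹' U'
      rw [hUV]
      exact hV'
    obtain ⟨h1, h2⟩ := key x hm
    exact ⟨hm, by rw [h2]; exact hfx⟩
  · rintro z ⟨hz, hzW⟩
    obtain ⟨h1, h2⟩ := key z hz
    exact ⟨h1, by rwa [← h2]⟩

/-- If `φ : Z ⟶ X` is an immersion, `Z(K)` has the subspace topology of `X(K)`. -/
theorem isEmbedding_map (φ : X ⟶ Y) [φ.IsOver (Spec (.of K))] [IsImmersion φ] :
    IsEmbedding (map φ : RationalPoints K X → RationalPoints K Y) :=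
  ⟨isInducing_map φ, fun _ _ h ↦ RationalPoints.ext
    ((cancel_mono φ).1 (congrArg RationalPoints.hom h))⟩

theorem continuousAt_evalD (x : RationalPoints K X) {U : X.Opens} (hx : x.pt ∈ U) (f : Γ(X, U)) :
    ContinuousAt (fun y : RationalPoints K X ↦ y.evalD f) x := by
  intro W hW
  obtain ⟨W', hW', hWo, hxW⟩ := mem_nhds_iff.1 hW
  refine mem_map.2 (mem_of_superset ((isOpen_eval f hWo).mem_nhds
    ⟨hx, by rwa [← evalD_eq _ hx]⟩) ?_)
  rintro y ⟨hy, hyW⟩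
  exact hW' (by rwa [← evalD_eq _ hy] at hyW)

variable [IsTopologicalDivisionRing K] [T1Space K]

theorem continuousAt_of_isAffineOpen {T : Type*} [TopologicalSpace T] (g : T → RationalPoints K X)
    (t : T) {U : X.Opens} (hU : IsAffineOpen U) (ht : ∀ᶠ s in 𝓝 t, (g s).pt ∈ U)
    (S : Set Γ(X, U)) (hS : Subring.closure S = ⊤)
    (hc : ∀ f ∈ S, ContinuousAt (fun s ↦ (g s).evalD f) t) : ContinuousAt g t := by
  have hc' : ∀ f : Γ(X, U), ContinuousAt (fun s ↦ (g s).evalD f) t := by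
    intro f
    have hf : f ∈ Subring.closure S := hS ▸ trivial
    induction hf using Subring.closure_induction with
    | mem x hx => exact hc x hx
    | zero => 
      refine continuousAt_const (y := 0) |>.congr ?_
      filter_upwards [ht] with s hs
      simp [evalD_eq _ hs]
    | one => 
      refine continuousAt_const (y := 1) |>.congr ?_
      filter_upwards [ht] with s hs
      simp [evalD_eq _ hs]
    | add x y _ _ hx hy => 
      refine (hx.add hy).congr ?_
      filter_upwards [ht] with s hs
      simp [evalD_eq _ hs]
    | neg x _ hx => 
      refine hx.neg.congr ?_
      filter_upwards [ht] with s hs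
      simp [evalD_eq _ hs]
    | mul x y _ _ hx hy => 
      refine (hx.mul hy).congr ?_
      filter_upwards [ht] with s hs
      simp [evalD_eq _ hs]
  refine tendsto_nhds_generateFrom_iff.2 ?_
  rintro _ ⟨V, f, W, hW, rfl⟩ ⟨hV, hfW⟩
  obtain ⟨b, hbV, hb⟩ := hU.exists_basicOpen_le ⟨_, hV⟩ ht.self_of_nhds
  have := hU.isLocalization_basicOpen b
  obtain ⟨⟨a, _, n, rfl⟩, hab⟩ := IsLocalization.surj (Submonoid.powers b)
    (X.presheaf.map (homOfLE hbV).op f)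
  have hbne : ContinuousAt (fun s ↦ (g s).evalD b) t := hc' b
  have hbt : (g t).evalD b ≠ 0 := by
    rw [evalD_eq _ ht.self_of_nhds]
    exact (pt_mem_basicOpen _ _ _).1 hb
  have hq : ContinuousAt (fun s ↦ (g s).evalD a / (g s).evalD b ^ n) t :=
    (hc' a).div₀ (hbne.pow n) (pow_ne_zero _ hbt)
  have key : ∀ s, (hs : (g s).pt ∈ U) → (g s).evalD b ≠ 0 → ∃ hs' : (g s).pt ∈ V,
      (g s).eval hs' f = (g s).evalD a / (g s).evalD b ^ n := by
    intro s hs hbs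
    rw [evalD_eq _ hs] at hbs
    have hsb := (pt_mem_basicOpen _ _ _).2 hbs
    refine ⟨hbV hsb, ?_⟩
    rw [evalD_eq _ hs, evalD_eq _ hs, eq_div_iff (pow_ne_zero _ hbs), ← eval_res _ hbV hsb]
    have := congrArg ((g s).eval hsb) hab
    rw [map_mul] at this
    have e : ∀ c : Γ(X, U), (g s).eval hsb (algebraMap Γ(X, U) Γ(X, X.basicOpen b) c) =
      (g s).eval hs c := fun c ↦ eval_res _ _ _ _
    rw [e, e, map_pow] at this
    exact this
  obtain ⟨h1, h2⟩ := key t ht.self_of_nhds hbt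
  filter_upwards [ht, hbne.eventually_ne hbt, hq (hW.mem_nhds (by rw [h2] at hfW; exact hfW))]
    with s h3 h4 h5
  obtain ⟨h6, h7⟩ := key s h3 h4
  exact ⟨h6, by rw [h7]; exact h5⟩

/-- The coordinates identify `𝔸ⁿ(K)` with the strong topology and `Kⁿ` with the product topology. -/
noncomputable def affineHomeo :
    RationalPoints K 𝔸(n; Spec (.of K)) ≃ₜ (n → K) where
  toFun x i := x.eval (U := ⊤) (Opens.mem_top _) (AffineSpace.coord _ i)
  invFun v := ⟨AffineSpace.homOfVector (𝟙 _) fun i ↦ (Scheme.ΓSpecIso (.of K)).inv (v i), by simp⟩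
  left_inv x := by
    apply RationalPoints.ext
    apply AffineSpace.hom_ext
    · rw [x.2]; simp
    · intro i
      rw [AffineSpace.homOfVector_appTop_coord]
      dsimp only
      rw [eval_top]
      simp
  right_inv v := by
    ext i
    dsimp only
    rw [eval_top, AffineSpace.homOfVector_appTop_coord]
    simp
  continuous_toFun := by
    refine continuous_pi fun i ↦ ⟨fun W hW ↦ isOpen_generateFrom_of_mem ⟨⊤, AffineSpace.coord _ i, W, hW, ?_⟩⟩
    ext x
    exact ⟨fun h ↦ ⟨Opens.mem_top _, h⟩, fun h ↦ h.2⟩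
  continuous_invFun := by
    refine continuous_iff_continuousAt.2 fun v ↦ ?_
    refine continuousAt_of_isAffineOpen _ v (isAffineOpen_top _) (.of_forall fun _ ↦ trivial)
      _ closure_coord_union_const ?_
    rintro _ (⟨i, rfl⟩ | ⟨c, rfl⟩)
    · refine (continuous_apply i).continuousAt.congr (.of_forall fun w ↦ ?_)
      dsimp only
      rw [evalD_eq _ (Opens.mem_top _), eval_top, AffineSpace.homOfVector_appTop_coord]
      simp
    · refine (continuousAt_const (y := c)).congr (.of_forall fun w ↦ ?_)
      dsimp only
      rw [evalD_eq _ (Opens.mem_top _), eval_over]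

variable [Z.Over (Spec (.of K))] [fst.IsOver (Spec (.of K))] [snd.IsOver (Spec (.of K))]

/-- `(X × Y)(K) = X(K) × Y(K)` with the product topology. -/
theorem isHomeomorph_prod (H : IsPullback fst snd (X ↘ Spec (.of K)) (Y ↘ Spec (.of K))) :
    IsHomeomorph fun z : RationalPoints K Z ↦ (z.map fst, z.map snd) := by
  let e : RationalPoints K Z ≃ RationalPoints K X × RationalPoints K Y :=
    { toFun := fun z ↦ (z.map fst, z.map snd)
      invFun := fun p ↦ ⟨H.lift p.1.hom p.2.hom (by rw [p.1.hom_over, p.2.hom_over]), by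
        rw [← comp_over fst, H.lift_fst_assoc, p.1.hom_over]⟩
      left_inv := fun z ↦ RationalPoints.ext (H.hom_ext (by simp [map]) (by simp [map]))
      right_inv := fun p ↦ Prod.ext (RationalPoints.ext (by simp [map]))
        (RationalPoints.ext (by simp [map])) }
  refine (Homeomorph.mk e ?_ ?_).isHomeomorph
  · exact (continuous_map fst).prodMk (continuous_map snd)
  · refine continuous_iff_continuousAt.2 fun p ↦ ?_
    obtain ⟨_, ⟨U, hU, rfl⟩, hxU, -⟩ := X.isBasis_affineOpens.exists_subset_of_mem_open
      (Set.mem_univ p.1.pt) isOpen_univ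
    obtain ⟨_, ⟨V, hV, rfl⟩, hxV, -⟩ := Y.isBasis_affineOpens.exists_subset_of_mem_open
      (Set.mem_univ p.2.pt) isOpen_univ
    obtain ⟨hA, hcl⟩ := closure_appLE H hU hV
    have hf : ∀ q, (e.symm q).map fst = q.1 := fun q ↦ congr($(e.apply_symm_apply q).1)
    have hs : ∀ q, (e.symm q).map snd = q.2 := fun q ↦ congr($(e.apply_symm_apply q).2)
    have hm : ∀ q : RationalPoints K X × RationalPoints K Y, q.1.pt ∈ U → q.2.pt ∈ V →
        (e.symm q).pt ∈ fst ⁻¹ᵁ U ⊓ snd ⁻¹ᵁ V := by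
      intro q h1 h2
      rw [← hf q, pt_map] at h1
      rw [← hs q, pt_map] at h2
      exact ⟨h1, h2⟩
    have hE := (continuous_fst.tendsto p).eventually ((isOpen_pt_mem U).mem_nhds hxU) |>.and
      ((continuous_snd.tendsto p).eventually ((isOpen_pt_mem V).mem_nhds hxV))
    refine continuousAt_of_isAffineOpen _ p hA (hE.mono fun q hq ↦ hm q hq.1 hq.2) _ hcl ?_
    rintro _ (⟨a, rfl⟩ | ⟨a, rfl⟩)
    · refine ((continuousAt_evalD _ hxU a).comp (f := Prod.fst) continuousAt_fst).congr ?_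
      filter_upwards [hE] with q hq
      change _ = (e.symm q).evalD _
      rw [evalD_map_appLE fst _ _ (hm q hq.1 hq.2), hf]
      rfl
    · refine ((continuousAt_evalD _ hxV a).comp (f := Prod.snd) continuousAt_snd).congr ?_
      filter_upwards [hE] with q hq
      change _ = (e.symm q).evalD _
      rw [evalD_map_appLE snd _ _ (hm q hq.1 hq.2), hs]
      rfl

end StrongTopology

end RationalPoints

/-- A morphism of schemes is étale at a point if its restriction to some Zariski open neighbourhood
of the point is étale. -/
def IsEtaleAt {X Y : Scheme.{u}} (φ : X ⟶ Y) (x : X) : Prop :=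
  ∃ U : X.Opens, x ∈ U ∧ Etale (U.ι ≫ φ)

/-! Near `p` the morphism is standard étale: on suitable affine opens `U` and `V` the ring of `U` is
`(A[x]/(f))` with `g` inverted, where `A` is the ring of `V` and `f'` is invertible wherever `f = 0`
and `g ≠ 0`. A rational point of `U` over `y` is therefore the same as a root in `K` of the
specialised polynomial `f_y` at which `g_y` does not vanish, and such a root is simple.

The coefficients of `f_y` are regular functions of `y`, hence strongly continuous. Over a complete
field a simple root moves continuously with the coefficients and is unique near the given one
(`exists_continuousOn_simple_root`, from the inverse function theorem). So near `φ(p)` there is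
exactly one nearby root, `ψ (a y)`, and it defines a local section of `φ` on rational points.

The section is continuous because the strong topology on an affine open is tested on ring generators
(`continuousAt_of_isAffineOpen`). Here these are the functions pulled back from `V`, the root `x`,
and the inverse of `g(x)` (`StandardEtalePresentation.closure_eq_top`). -/

/-! ### Continuity of simple roots -/

theorem exists_continuousOn_simple_root_of_nontriviallyNormed {K : Type*} [NontriviallyNormedField K] [CompleteSpace K] {n : ℕ}
    (a₀ : Fin n → K) (x₀ : K)
    (h₁ : (∑ i : Fin n, Polynomial.monomial (i : ℕ) (a₀ i)).derivative.eval x₀ ≠ 0) :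
    ∃ (O : Set ((Fin n → K) × K)) (N : Set (Fin n → K)) (ψ : (Fin n → K) → K),
      IsOpen O ∧ (a₀, x₀) ∈ O ∧ IsOpen N ∧ ContinuousOn ψ N ∧
      (∀ a ∈ N, (a, ψ a) ∈ O ∧ (∑ i : Fin n, Polynomial.monomial (i : ℕ) (a i)).eval (ψ a) = 0) ∧
      ∀ a x, (a, x) ∈ O → (∑ i : Fin n, Polynomial.monomial (i : ℕ) (a i)).eval x = 0 →
        a ∈ N ∧ ψ a = x := by
  let F : (Fin n → K) × K → K := fun v ↦ (∑ i : Fin n, Polynomial.monomial (i : ℕ) (v.1 i)).eval v.2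
  obtain ⟨D, hD⟩ : ∃ D : (Fin n → K) × K →L[K] K, HasStrictFDerivAt F D (a₀, x₀) := by
    refine ⟨_, (HasStrictFDerivAt.fun_sum (u := Finset.univ) fun i _ ↦
      (((ContinuousLinearMap.proj (R := K) (φ := fun _ : Fin n ↦ K) i).hasStrictFDerivAt.comp _
        hasStrictFDerivAt_fst).mul' (hasStrictFDerivAt_snd.pow (i : ℕ)))).congr_of_eventuallyEq
      (.of_forall fun v ↦ ?_)⟩
    simp [F, Polynomial.eval_finsetSum]
  set c := (∑ i : Fin n, Polynomial.monomial (i : ℕ) (a₀ i)).derivative.eval x₀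
  have hc : c ≠ 0 := h₁
  -- No formula for `D` is needed: restricted to the line `a = a₀` it must be the ordinary
  -- derivative of the polynomial at `x₀`, by uniqueness of derivatives.
  have hDc : ∀ h, D (0, h) = h * c := by
    intro h
    have e₁ : HasStrictFDerivAt (fun x ↦ F (a₀, x)) (D.comp (.inr K (Fin n → K) K)) x₀ :=
      HasStrictFDerivAt.comp (f := fun x ↦ (a₀, x)) x₀ hD
        ((hasStrictFDerivAt_const a₀ x₀).prodMk (hasStrictFDerivAt_id x₀))
    have e₂ := e₁.hasFDerivAt.unique
      ((∑ i : Fin n, Polynomial.monomial (i : ℕ) (a₀ i)).hasDerivAt x₀).hasFDerivAt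
    simpa [c] using congr($e₂ h)
  have hDs : ∀ a h, D (a, h) = D (a, 0) + h * c := by
    intro a h
    rw [← hDc, ← map_add]
    simp
  -- The derivative of `(a, x) ↦ (a, F (a, x))` is block triangular with diagonal blocks `1` and
  -- `c`, hence invertible since `c ≠ 0`.
  let E : ((Fin n → K) × K) ≃L[K] ((Fin n → K) × K) := .equivOfInverse
    ((ContinuousLinearMap.fst K _ _).prod D)
    ((ContinuousLinearMap.fst K _ _).prod (c⁻¹ • (ContinuousLinearMap.snd K _ _ -
      D.comp ((ContinuousLinearMap.inl K _ _).comp (ContinuousLinearMap.fst K _ _)))))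
    (fun ⟨a, h⟩ ↦ by simp [hDs a h, mul_comm, hc])
    (fun ⟨a, h⟩ ↦ by simp [hDs a (c⁻¹ * _), mul_comm, hc])
  have hΦ : HasStrictFDerivAt (fun v ↦ (v.1, F v)) (E : ((Fin n → K) × K) →L[K] ((Fin n → K) × K))
      (a₀, x₀) := hasStrictFDerivAt_fst.prodMk hD
  let e := hΦ.toOpenPartialHomeomorph
  have he : ∀ v, e v = (v.1, F v) := fun _ ↦ rfl
  have hsymm : ∀ a, (a, (0 : K)) ∈ e.target →
      (e.symm (a, 0)).1 = a ∧ F (e.symm (a, 0)) = 0 := fun a ha ↦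
    Prod.ext_iff.1 ((he _).symm.trans (e.right_inv ha))
  -- The local inverse straightens the zero locus `F = 0` to the slice with second coordinate `0`,
  -- so `ψ` reads off the root over `a`.
  refine ⟨e.source, {a | (a, 0) ∈ e.target}, fun a ↦ (e.symm (a, 0)).2, e.open_source,
    hΦ.mem_toOpenPartialHomeomorph_source, e.open_target.preimage (by fun_prop), ?_, ?_, ?_⟩
  · exact continuous_snd.comp_continuousOn
      (e.continuousOn_symm.comp (by fun_prop) fun a ha ↦ ha)
  · intro a ha
    obtain ⟨h1, h2⟩ := hsymm a ha
    have h3 : (a, (e.symm (a, 0)).2) = e.symm (a, 0) := Prod.ext h1.symm rfl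
    refine ⟨h3 ▸ e.map_target ha, ?_⟩
    rw [← h3] at h2
    exact h2
  · intro a x hax hx
    have h : e (a, x) = (a, 0) := Prod.ext rfl hx
    refine ⟨Set.mem_ofPred.2 (h ▸ e.map_source hax), ?_⟩
    change (e.symm (a, 0)).2 = x
    rw [← h, e.left_inv hax]

/-- A simple root of a polynomial over a complete normed field depends continuously on the
coefficients: near `(a₀, x₀)` the zero locus of the universal polynomial is the graph of `ψ`. -/
theorem exists_continuousOn_simple_root {K : Type*} [NormedField K] [CompleteSpace K] {n : ℕ}
    (a₀ : Fin n → K) (x₀ : K)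
    (h₀ : (∑ i : Fin n, Polynomial.monomial (i : ℕ) (a₀ i)).eval x₀ = 0)
    (h₁ : (∑ i : Fin n, Polynomial.monomial (i : ℕ) (a₀ i)).derivative.eval x₀ ≠ 0) :
    ∃ (O : Set ((Fin n → K) × K)) (N : Set (Fin n → K)) (ψ : (Fin n → K) → K),
      IsOpen O ∧ (a₀, x₀) ∈ O ∧ IsOpen N ∧ ContinuousOn ψ N ∧
      (∀ a ∈ N, (a, ψ a) ∈ O ∧ (∑ i : Fin n, Polynomial.monomial (i : ℕ) (a i)).eval (ψ a) = 0) ∧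
      ∀ a x, (a, x) ∈ O → (∑ i : Fin n, Polynomial.monomial (i : ℕ) (a i)).eval x = 0 →
        a ∈ N ∧ ψ a = x := by
  obtain h | ⟨h, rfl⟩ := NormedField.discreteTopology_or_nontriviallyNormedField K
  -- For the trivial absolute value points are open, so singletons suffice. Since `N` contains `a₀`
  -- here, `x₀` must itself be a root.
  · refine ⟨{(a₀, x₀)}, {a₀}, fun _ ↦ x₀, isOpen_discrete _, rfl, isOpen_discrete _,
      continuousOn_const, ?_, ?_⟩
    · rintro _ rfl
      exact ⟨rfl, h₀⟩
    · rintro a x hax -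
      obtain ⟨rfl, rfl⟩ := Prod.ext_iff.1 hax
      exact ⟨rfl, rfl⟩
  · exact exists_continuousOn_simple_root_of_nontriviallyNormed a₀ x₀ h₁

/-! ### Rational points of an affine open as ring homomorphisms to `K` -/

namespace RationalPoints

variable {K : Type u} [Field K] {X Y : Scheme.{u}} [X.Over (Spec (.of K))] [Y.Over (Spec (.of K))]

theorem hom_eq_SpecMap_eval (x : RationalPoints K X) {U : X.Opens} (hU : IsAffineOpen U)
    (hx : x.pt ∈ U) : x.hom = Spec.map (CommRingCat.ofHom (x.eval hx)) ≫ hU.fromSpec := by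
  have h := IsAffineOpen.SpecMap_appLE_fromSpec x.hom hU (isAffineOpen_top _)
    (x.top_le_preimage hx)
  rw [IsAffineOpen.fromSpec_top] at h
  simp only [eval, CommRingCat.ofHom_hom, Spec.map_comp, Category.assoc, h]
  simp [Scheme.isoSpec_Spec_inv]

/-- This is how points of a fibre are constructed. A ring homomorphism `χ` suffices: compatibility
with evaluation at `y` already forces the resulting morphism to be over `K`, because `y` is. -/
theorem exists_of_comp_appLE (φ : X ⟶ Y) [φ.IsOver (Spec (.of K))] {V : Y.Opens} {U : X.Opens}
    (hV : IsAffineOpen V) (hU : IsAffineOpen U) (i : U ≤ φ ⁻¹ᵁ V) (y : RationalPoints K Y)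
    (hy : y.pt ∈ V) (χ : Γ(X, U) →+* K) (h : χ.comp (φ.appLE V U i).hom = y.eval hy) :
    ∃ (x : RationalPoints K X) (hx : x.pt ∈ U), x.map φ = y ∧ x.eval hx = χ := by
  have hφ : (Spec.map (CommRingCat.ofHom χ) ≫ hU.fromSpec) ≫ φ = y.hom := by
    rw [y.hom_eq_SpecMap_eval hV hy, Category.assoc, ← IsAffineOpen.SpecMap_appLE_fromSpec φ hV hU i,
      ← Spec.map_comp_assoc, ← h]
    rfl
  let x : RationalPoints K X := ⟨Spec.map (CommRingCat.ofHom χ) ≫ hU.fromSpec, by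
    rw [← comp_over φ, ← Category.assoc, hφ, y.hom_over]⟩
  have hx : x.pt ∈ U := by
    change _ ∈ (U : Set X)
    rw [← hU.range_fromSpec]
    exact ⟨_, (Scheme.Hom.comp_apply _ _ _).symm⟩
  refine ⟨x, hx, RationalPoints.ext hφ, ?_⟩
  have h1 := x.hom_eq_SpecMap_eval hU hx
  have h2 := Spec.map_injective ((cancel_mono hU.fromSpec).1 h1)
  exact (congr(($h2).hom)).symm

theorem eq_of_eval_eq {U : X.Opens} (hU : IsAffineOpen U) {x y : RationalPoints K X} (hx : x.pt ∈ U)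
    (hy : y.pt ∈ U) (h : x.eval hx = y.eval hy) : x = y :=
  RationalPoints.ext (by rw [x.hom_eq_SpecMap_eval hU hx, y.hom_eq_SpecMap_eval hU hy, h])

theorem eval_appLE (φ : X ⟶ Y) [φ.IsOver (Spec (.of K))] (x : RationalPoints K X)
    {V : Y.Opens} {U : X.Opens} (i : U ≤ φ ⁻¹ᵁ V) (hx : x.pt ∈ U) (hy : (x.map φ).pt ∈ V) :
    (x.eval hx).comp (φ.appLE V U i).hom = (x.map φ).eval hy := by
  ext f
  rw [← evalD_eq _ hy, ← evalD_map_appLE φ x i hx, evalD_eq _ hx]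
  rfl

end RationalPoints

/-! ### Local structure of étale morphisms -/

/-- Every element is a polynomial in `P.x` over `R` divided by a power of `g(P.x)`, and `y` is the
inverse of `g(P.x)`. -/
theorem StandardEtalePresentation.closure_eq_top {R S : Type*} [CommRing R] [CommRing S]
    [Algebra R S] (P : StandardEtalePresentation R S) {y : S}
    (hy : Polynomial.aeval P.x P.g * y = 1) :
    Subring.closure (Set.range (algebraMap R S) ∪ {P.x, y}) = ⊤ := by
  rw [eq_top_iff]
  rintro s -
  obtain ⟨p, n, h⟩ := P.exists_mul_aeval_x_g_pow_eq_aeval_x s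
  have hs : s = Polynomial.aeval P.x p * y ^ n := by
    rw [← h, mul_assoc, ← mul_pow, hy, one_pow, mul_one]
  rw [hs]
  refine mul_mem ?_ (pow_mem (Subring.subset_closure (by simp)) _)
  rw [Polynomial.aeval_eq_sum_range]
  refine sum_mem fun i _ ↦ ?_
  rw [Algebra.smul_def]
  exact mul_mem (Subring.subset_closure (by simp)) (pow_mem (Subring.subset_closure (by simp)) _)

theorem IsEtaleAt.exists_isAffineOpen_etale {X Y : Scheme.{u}} {φ : X ⟶ Y} {x : X} (h : IsEtaleAt φ x) :
    ∃ (V : Y.Opens) (U : X.Opens) (i : U ≤ φ ⁻¹ᵁ V), IsAffineOpen V ∧ IsAffineOpen U ∧ x ∈ U ∧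
      (φ.appLE V U i).hom.Etale := by
  obtain ⟨W, hxW, hW⟩ := h
  obtain ⟨_, ⟨V : Y.Opens, hV, rfl⟩, hxV, -⟩ := Y.isBasis_affineOpens.exists_subset_of_mem_open
    (Set.mem_univ (φ x)) isOpen_univ
  obtain ⟨_, ⟨U : X.Opens, hU, rfl⟩, hxU, hUW⟩ := X.isBasis_affineOpens.exists_subset_of_mem_open
    (show x ∈ ((φ ⁻¹ᵁ V ⊓ W : X.Opens) : Set X) from ⟨hxV, hxW⟩) (φ ⁻¹ᵁ V ⊓ W).2
  have i : U ≤ φ ⁻¹ᵁ V := fun y hy ↦ (hUW hy).1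
  have j : U ≤ W := fun y hy ↦ (hUW hy).2
  refine ⟨V, U, i, hV, hU, hxU, ?_⟩
  have hE : Etale (U.ι ≫ φ) := by
    rw [← X.homOfLE_ι j, Category.assoc]
    infer_instance
  have : IsAffine U := hU
  have hle : (⊤ : U.toScheme.Opens) ≤ (U.ι ≫ φ) ⁻¹ᵁ V := by
    rw [Scheme.Hom.comp_preimage, ← Scheme.Opens.ι_preimage_self U]
    exact fun y hy ↦ i hy
  have h1 := hE.etale_appLE hV (isAffineOpen_top U.toScheme) hle
  have h2 : φ.appLE V U i = (U.ι ≫ φ).appLE V ⊤ hle ≫ U.topIso.hom := by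
    have hle' : (⊤ : U.toScheme.Opens) ≤ U.ι ⁻¹ᵁ (φ ⁻¹ᵁ V) := hle
    have h3 : (U.ι ≫ φ).appLE V ⊤ hle = φ.app V ≫ U.ι.appLE (φ ⁻¹ᵁ V) ⊤ hle' :=
      Scheme.Hom.comp_appLE ..
    rw [h3, Scheme.Opens.ι_appLE, Scheme.Opens.topIso_hom]
    exact (congrArg (φ.app V ≫ ·) (X.presheaf.map_comp _ _)).trans (Category.assoc _ _ _).symm
  rw [h2]
  exact (RingHom.Etale.respectsIso).1 _ U.topIso.commRingCatIsoToRingEquiv h1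

/-- Near a rational point, an étale morphism is given by a standard étale algebra. -/
theorem IsEtaleAt.exists_standardEtalePresentation {K : Type u} [Field K] {X Y : Scheme.{u}}
    [X.Over (Spec (.of K))] {φ : X ⟶ Y} {p : RationalPoints K X} (h : IsEtaleAt φ p.pt) :
    ∃ (V : Y.Opens) (U : X.Opens) (i : U ≤ φ ⁻¹ᵁ V), IsAffineOpen V ∧ IsAffineOpen U ∧ p.pt ∈ U ∧
      letI := (φ.appLE V U i).hom.toAlgebra
      Nonempty (StandardEtalePresentation Γ(Y, V) Γ(X, U)) := by
  obtain ⟨V, U, i, hV, hU, hp, hE⟩ := h.exists_isAffineOpen_etale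
  let _ := (φ.appLE V U i).hom.toAlgebra
  have : Algebra.Etale Γ(Y, V) Γ(X, U) := hE
  -- The prime of the point `p`. The `f` found below lies outside it, so `p` stays in the basic open
  -- set of `f`.
  let Q : Ideal Γ(X, U) := RingHom.ker (p.eval hp)
  have : Q.IsPrime := RingHom.ker_isPrime _
  obtain ⟨f, hfQ, hf⟩ := Algebra.IsEtaleAt.exists_isStandardEtale (R := Γ(Y, V)) Q
  have hpf : p.pt ∈ X.basicOpen f := (p.pt_mem_basicOpen hp f).2 hfQ
  have j : X.basicOpen f ≤ U := X.basicOpen_le f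
  refine ⟨V, X.basicOpen f, j.trans i, hV, hU.basicOpen f, hpf, ?_⟩
  let _ := (φ.appLE V (X.basicOpen f) (j.trans i)).hom.toAlgebra
  have := hU.isLocalization_basicOpen f
  have : IsScalarTower Γ(Y, V) Γ(X, U) Γ(X, X.basicOpen f) := .of_algebraMap_eq' (by
    change _ = ((φ.appLE V U i) ≫ X.presheaf.map (homOfLE j).op).hom
    rw [Scheme.Hom.appLE_map]
    rfl)
  let e : Localization.Away f ≃ₐ[Γ(Y, V)] Γ(X, X.basicOpen f) :=
    (IsLocalization.algEquiv (Submonoid.powers f) _ _).restrictScalars Γ(Y, V)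
  exact (Algebra.IsStandardEtale.of_equiv e).nonempty_standardEtalePresentation

/-! ### The local inverse on rational points -/

open TopologicalSpace Topology in
/-- A morphism of `K`-schemes that is étale at a rational point `p` is a local homeomorphism at `p`
for the strong topology. -/
theorem IsEtaleAt.exists_openPartialHomeomorph {K : Type u} [NormedField K] [CompleteSpace K]
    {X Y : Scheme.{u}} [X.Over (Spec (.of K))] [Y.Over (Spec (.of K))]
    (φ : X ⟶ Y) [φ.IsOver (Spec (.of K))] {p : RationalPoints K X} (h : IsEtaleAt φ p.pt) :
    ∃ e : OpenPartialHomeomorph (RationalPoints K X) (RationalPoints K Y),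
      p ∈ e.source ∧ ∀ q ∈ e.source, e q = RationalPoints.map φ q := by
  obtain ⟨V, U, i, hV, hU, hp, ⟨P⟩⟩ := h.exists_standardEtalePresentation
  let α := (φ.appLE V U i).hom
  let _ : Algebra Γ(Y, V) Γ(X, U) := α.toAlgebra
  obtain ⟨z, hz⟩ := P.hasMap.2.exists_right_inv
  have hmap : ∀ x : RationalPoints K X, x.pt ∈ U → (x.map φ).pt ∈ V := fun x hx ↦ by
    rw [RationalPoints.pt_map]; exact i hx
  -- the coefficients of the defining polynomial, as functions on the rational points of `Y`
  let a : RationalPoints K Y → Fin (P.f.natDegree + 1) → K := fun y j ↦ y.evalD (P.f.coeff j)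
  let F : (Fin (P.f.natDegree + 1) → K) → Polynomial K :=
    fun c ↦ ∑ j : Fin (P.f.natDegree + 1), Polynomial.monomial (j : ℕ) (c j)
  have hF : ∀ (y : RationalPoints K Y) (hy : y.pt ∈ V), P.f.map (y.eval hy) = F (a y) := by
    intro y hy
    conv_lhs => rw [P.f.as_sum_range, Polynomial.map_sum, Finset.sum_range]
    simp [F, a, RationalPoints.evalD_eq _ hy]
  have hX : ∀ (x : RationalPoints K X) (hx : x.pt ∈ U) (g : Polynomial Γ(Y, V)),
      (g.map ((x.map φ).eval (hmap x hx))).eval (x.eval hx P.x) =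
        x.eval hx (Polynomial.aeval P.x g) := by
    intro x hx g
    rw [Polynomial.eval_map, ← RationalPoints.eval_appLE φ x i hx, ← Polynomial.hom_eval₂]
    rfl
  have hroot : ∀ (x : RationalPoints K X) (hx : x.pt ∈ U),
      (F (a (x.map φ))).eval (x.eval hx P.x) = 0 := fun x hx ↦ by
    rw [← hF _ (hmap x hx), hX, P.hasMap.1, map_zero]
  have hG : ∀ (x : RationalPoints K X) (hx : x.pt ∈ U),
      (P.g.map ((x.map φ).eval (hmap x hx))).eval (x.eval hx P.x) ≠ 0 := fun x hx ↦ by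
    rw [hX]; exact (P.hasMap.2.map (x.eval hx)).ne_zero
  -- The root at `p` is simple because in a standard étale algebra `f'(P.x)` is a unit.
  obtain ⟨O, N, ψ, hO, hpO, hN, hψ, h1, h2⟩ := exists_continuousOn_simple_root (a (p.map φ))
    (p.eval hp P.x) (hroot p hp) (by
      change (F (a (p.map φ))).derivative.eval _ ≠ 0
      rw [← hF _ (hmap p hp), Polynomial.derivative_map, hX]
      exact (P.hasMap.isUnit_derivative_f.map (p.eval hp)).ne_zero)
  have ha : ∀ y : RationalPoints K Y, y.pt ∈ V → ContinuousAt a y := fun y hy ↦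
    continuousAt_pi.2 fun j ↦ y.continuousAt_evalD hy _
  have hcψ : ∀ y : RationalPoints K Y, y.pt ∈ V → a y ∈ N → ContinuousAt (fun y ↦ ψ (a y)) y :=
    fun y hy hyN ↦ (hψ.continuousAt (hN.mem_nhds hyN)).comp (f := a) (ha y hy)
  -- the value of `g` at the root `ψ`
  let G : RationalPoints K Y → K := fun y ↦
    ∑ j ∈ Finset.range (P.g.natDegree + 1), y.evalD (P.g.coeff j) * ψ (a y) ^ j
  have hGc : ∀ y : RationalPoints K Y, y.pt ∈ V → a y ∈ N → ContinuousAt G y := fun y hy hyN ↦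
    tendsto_finsetSum _ fun j _ ↦
      (y.continuousAt_evalD hy (P.g.coeff j)).mul ((hcψ y hy hyN).pow j)
  have hGe : ∀ (y : RationalPoints K Y) (hy : y.pt ∈ V),
      (P.g.map (y.eval hy)).eval (ψ (a y)) = G y := by
    intro y hy
    rw [Polynomial.eval_map, Polynomial.eval₂_eq_sum_range]
    simp [G, RationalPoints.evalD_eq _ hy]
  let S : Set (RationalPoints K X) :=
    {x | x.pt ∈ U ∧ (a (x.map φ), x.evalD P.x) ∈ O}
  -- A root of `f` comes from a point of `U` only where `g` is nonzero, hence the condition on `G`.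
  let T : Set (RationalPoints K Y) := {y | y.pt ∈ V ∧ a y ∈ N ∧ G y ≠ 0}
  have hS : ∀ x (hx : x ∈ S), a (x.map φ) ∈ N ∧ ψ (a (x.map φ)) = x.eval hx.1 P.x := by
    intro x hx
    have h3 := hx.2
    rw [RationalPoints.evalD_eq _ hx.1] at h3
    exact h2 _ _ h3 (hroot x hx.1)
  have hST : ∀ x ∈ S, x.map φ ∈ T := by
    intro x hx
    refine ⟨hmap x hx.1, (hS x hx).1, ?_⟩
    rw [← hGe _ (hmap x hx.1), (hS x hx).2]
    exact hG x hx.1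
  -- With `K` an algebra through evaluation at `y`, the universal property of the standard étale
  -- algebra turns the root `ψ (a y)` into a point over `y`.
  have hTS : ∀ y ∈ T, ∃ x ∈ S, x.map φ = y := by
    rintro y ⟨hy, hyN, hyG⟩
    let _ : Algebra Γ(Y, V) K := (y.eval hy).toAlgebra
    have hm : P.HasMap (ψ (a y)) := by
      constructor
      · rw [Polynomial.aeval_def, ← Polynomial.eval_map]
        exact (congrArg _ (hF y hy)).trans (h1 _ hyN).2
      · rw [Polynomial.aeval_def, ← Polynomial.eval_map]
        exact (isUnit_iff_ne_zero.2 hyG : IsUnit (G y)) |> (hGe y hy).symm.subst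
    let χ : Γ(X, U) →ₐ[Γ(Y, V)] K := (P.lift _ hm).comp P.equivRing.toAlgHom
    have hχx : χ P.x = ψ (a y) := by simp [χ]
    obtain ⟨x, hx, hxy, hxχ⟩ := RationalPoints.exists_of_comp_appLE φ hV hU i y hy χ.toRingHom
      χ.comp_algebraMap
    refine ⟨x, ⟨hx, ?_⟩, hxy⟩
    rw [hxy, RationalPoints.evalD_eq _ hx, hxχ]
    exact hχx ▸ (h1 _ hyN).1
  -- Supplies a default value so that `inv` can be a total function; outside `T` its values are
  -- irrelevant.
  have : Nonempty (RationalPoints K X) := ⟨p⟩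
  choose! inv hinvS hinv using hTS
  -- A point of `U` is determined by its image and its value at `P.x`; on `S` the latter is `ψ` of
  -- the coefficients at the image.
  have hinj : ∀ x ∈ S, ∀ x' ∈ S, x.map φ = x'.map φ → x = x' := by
    intro x hx x' hx' hxx
    refine RationalPoints.eq_of_eval_eq hU hx.1 hx'.1 ?_
    have hc : ∀ w : RationalPoints K X, ∀ hw : w.pt ∈ U,
        (w.eval hw).comp α = (w.map φ).eval (hmap w hw) :=
      fun w hw ↦ RationalPoints.eval_appLE φ w i hw _
    let _ : Algebra Γ(Y, V) K := ((x.map φ).eval (hmap x hx.1)).toAlgebra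
    let χ : Γ(X, U) →ₐ[Γ(Y, V)] K := ⟨x.eval hx.1, fun r ↦ congr($(hc x hx.1) r)⟩
    let χ' : Γ(X, U) →ₐ[Γ(Y, V)] K := ⟨x'.eval hx'.1, fun r ↦ by
      refine (congr($(hc x' hx'.1) r)).trans ?_
      simp only [← hxx]
      rfl⟩
    have hχ : χ = χ' := P.hom_ext (by
      change x.eval hx.1 P.x = x'.eval hx'.1 P.x
      rw [← (hS x hx).2, ← (hS x' hx').2, hxx])
    exact congr(($hχ : Γ(X, U) →+* K))
  have hSo : IsOpen S := by
    refine isOpen_iff_mem_nhds.2 fun x hx ↦ ?_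
    have hc : ContinuousAt (fun x : RationalPoints K X ↦ (a (x.map φ), x.evalD P.x)) x :=
      ((ha _ (hmap x hx.1)).comp (RationalPoints.continuous_map φ).continuousAt).prodMk
        (x.continuousAt_evalD hx.1 _)
    filter_upwards [(RationalPoints.isOpen_pt_mem U).mem_nhds hx.1, hc (hO.mem_nhds hx.2)]
      with w hw hw' using ⟨hw, hw'⟩
  have hTo : IsOpen T := by
    refine isOpen_iff_mem_nhds.2 fun y hy ↦ ?_
    filter_upwards [(RationalPoints.isOpen_pt_mem V).mem_nhds hy.1,
      ha y hy.1 (hN.mem_nhds hy.2.1), (hGc y hy.1 hy.2.1).eventually_ne hy.2.2]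
      with w hw hw' hw'' using ⟨hw, hw', hw''⟩
  have hinvψ : ∀ y ∈ T, (inv y).evalD P.x = ψ (a y) := fun y hy ↦ by
    rw [RationalPoints.evalD_eq _ (hinvS y hy).1, ← (hS _ (hinvS y hy)).2, hinv y hy]
  have hic : ContinuousOn inv T := by
    refine hTo.continuousOn_iff.2 fun y hy ↦ ?_
    have hTn := hTo.mem_nhds hy
    -- Along `inv` the three kinds of generators become a regular function on `V`, the root `ψ (a
    -- y)`, and `(G y)⁻¹`.
    refine RationalPoints.continuousAt_of_isAffineOpen inv y hU
      (Filter.mem_of_superset hTn fun w hw ↦ (hinvS w hw).1) _ (P.closure_eq_top hz) ?_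
    rintro _ (⟨f, rfl⟩ | rfl | rfl)
    · refine (y.continuousAt_evalD hy.1 f).congr ?_
      filter_upwards [hTn] with w hw
      exact (congrArg (fun q ↦ q.evalD f) (hinv w hw)).symm.trans
        (RationalPoints.evalD_map_appLE φ (inv w) i (hinvS w hw).1 f).symm
    · refine (hcψ y hy.1 hy.2.1).congr ?_
      filter_upwards [hTn] with w hw using (hinvψ w hw).symm
    · refine ((hGc y hy.1 hy.2.1).inv₀ hy.2.2).congr ?_
      filter_upwards [hTn] with w hw
      have hw' := (hinvS w hw).1
      rw [RationalPoints.evalD_eq _ hw']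
      refine inv_eq_of_mul_eq_one_right ?_
      have h3 := hX (inv w) hw' P.g
      rw [← RationalPoints.evalD_eq _ hw' P.x, hinvψ w hw] at h3
      simp only [hinv w hw] at h3
      rw [hGe w hw.1] at h3
      rw [h3, ← map_mul, hz, map_one]
  exact ⟨{ toFun := RationalPoints.map φ
           invFun := inv
           source := S
           target := T
           map_source' := hST
           map_target' := hinvS
           left_inv' := fun x hx ↦ hinj _ (hinvS _ (hST x hx)) _ hx (hinv _ (hST x hx))
           right_inv' := hinv
           open_source := hSo
           open_target := hTo
           continuousOn_toFun := (RationalPoints.continuous_map φ).continuousOn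
           continuousOn_invFun := hic },
    ⟨hp, by rwa [RationalPoints.evalD_eq _ hp]⟩, fun _ _ ↦ rfl⟩

theorem mainTheorem2 {K : Type u} [NormedField K] [CompleteSpace K] (r : ℕ)
    (X : Scheme.{u}) [X.Over (Spec (.of K))] [IsVariety K X] (hr : topologicalKrullDim X = r)
    (φ : X ⟶ 𝔸(ULift.{u} (Fin r); Spec (.of K))) [φ.IsOver (Spec (.of K))]
    (p : RationalPoints K X) (hp : IsEtaleAt φ p.pt) :
    ∃ e : OpenPartialHomeomorph (RationalPoints K X)
        (RationalPoints K 𝔸(ULift.{u} (Fin r); Spec (.of K))),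
      p ∈ e.source ∧ ∀ q ∈ e.source, e q = RationalPoints.map φ q :=
  hp.exists_openPartialHomeomorph φ
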